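/- Let $N=\{1,2,3,\dots\}$ and let $\beta N$ be the space of ultrafilters on $N$, with basic open sets $\{p\in\beta N: A\in p\}$ for $A\subseteq N$, and with the multiplication defined by $A\in p\cdot q\iff\{n\in N:\{m\in N: nm\in A\}\in q\}\in p$. Identify each element of $N$ with the corresponding principal ultrafilter and put $N^*=\beta N\setminus N$, with the subspace topology. For $p,q\in\beta N$ write $p\mid_L q$ if $q=rp$ for some $r\in\beta N$. For $p,q\in N^*$ write $p\,C_L\,q$ if there is $r\in N^*$ such that $r\mid_L p$ and $r\mid_L q$, and let $\sim_L$ be the transitive closure of the relation $C_L$ on $N^*$. **Proposition.** The relation $\sim_L$ is an equivalence relation on $N^*$, and it has exactly $2^{\mathfrak c}$ equivalence classes $[p]_{\sim_L}=\{q\in N^*: p\sim_L q\}$, where $\mathfrak c=2^{\aleph_0}$. Each of these classes is nowhere dense in $N^*$ and is a left ideal of $\beta N$, that is, a nonempty set $L$ with $xp\in L$ for all $x\in\beta N$ and $p\in L$. -/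

import Mathlib

open Cardinal

attribute [local instance] Ultrafilter.mul

/-- `βN`: the space of ultrafilters on the positive integers, with the topology generated by the
sets `{p | A ∈ p}` and the multiplication `Ultrafilter.mul`. -/
abbrev BetaN : Type := Ultrafilter ℕ+

/-- The multiplication of `βN` is the usual one: `A ∈ p * q` iff `{n | A / n ∈ q} ∈ p`, where
`A / n = {m | n * m ∈ A}`. -/
theorem BetaN.mem_mul_iff (p q : BetaN) (A : Set ℕ+) :
    A ∈ p * q ↔ {n : ℕ+ | {m : ℕ+ | n * m ∈ A} ∈ q} ∈ p :=
  Iff.rfl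

/-- `N* = βN \ N`, where `N` is identified with the set of principal ultrafilters. -/
def NStar : Set BetaN := (Set.range (pure : ℕ+ → BetaN))ᶜ

/-- Left divisibility `p ∣_L q` on `βN`. -/
def LeftDvd (p q : BetaN) : Prop := ∃ r : BetaN, q = r * p

/-- The compatibility relation `C_L` on `N*`. -/
def CompatL (p q : NStar) : Prop := ∃ r ∈ NStar, LeftDvd r p ∧ LeftDvd r q

/-- `∼_L`: the transitive closure of `C_L`. -/
def SimL : NStar → NStar → Prop := Relation.TransGen CompatL

/-- The class `[p] = {q ∈ N* | p ∼_L q}`, as a subset of the space `N*`. -/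
def simLClass (p : NStar) : Set NStar := {q | SimL p q}

/-- Left ideals of the semigroup `βN`: nonempty sets `L` with `βN * L ⊆ L`. -/
def IsLeftIdealBetaN (L : Set BetaN) : Prop :=
  L.Nonempty ∧ ∀ x : BetaN, ∀ p ∈ L, x * p ∈ L

/-! For fixed n and all large m, `logLog (n * m)` exceeds `logLog m` by 0 or 1. Hence, for
nonprincipal p, the image of x * p under `logLog` is that of p or its shift by 1, and the image up
to shifts is an invariant of `SimL` (`SimL.shiftEquiv`). Shift classes are countable and `logLog`
has the section k ↦ 2 ^ 2 ^ k, so the 2 ^ 𝔠 ultrafilters on ℕ force 2 ^ 𝔠 classes. For nowhere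
density, every infinite set contains a sequence whose `logLog` values have growing gaps; its even
and odd terms cannot both carry nonprincipal members of one class. -/

/-- The integer part of the iterated binary logarithm of a positive integer. -/
def logLog (m : ℕ+) : ℕ := Nat.log 2 (Nat.log 2 m)

theorem logLog_le_logLog_mul (n m : ℕ+) : logLog m ≤ logLog (n * m) := by
  unfold logLog
  apply Nat.log_mono_right
  apply Nat.log_mono_right
  rw [PNat.mul_coe]
  exact Nat.le_mul_of_pos_left _ n.pos

/-- The hypothesis gives log (n * m) ≤ 2 log m, and doubling raises the outer logarithm by one. -/
theorem logLog_mul_le {n m : ℕ+} (h : Nat.log 2 n + 1 ≤ Nat.log 2 m) :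
    logLog (n * m) ≤ logLog m + 1 := by
  unfold logLog
  have h1 : Nat.log 2 ((n * m : ℕ+) : ℕ) ≤ Nat.log 2 m * 2 := by
    have h2 : Nat.log 2 ((n * m : ℕ+) : ℕ) < Nat.log 2 n + 1 + (Nat.log 2 m + 1) := by
      apply Nat.log_lt_of_lt_pow (by simp)
      rw [PNat.mul_coe, pow_add]
      exact Nat.mul_lt_mul'' (Nat.lt_pow_succ_log_self one_lt_two _)
        (Nat.lt_pow_succ_log_self one_lt_two _)
    omega
  calc _ ≤ Nat.log 2 (Nat.log 2 m * 2) := Nat.log_mono_right h1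
    _ = _ := Nat.log_mul_base one_lt_two (by omega)

theorem finite_setOf_log_lt (k : ℕ) : {m : ℕ+ | Nat.log 2 m < k}.Finite := by
  apply (Set.finite_Iic ((2 : ℕ+) ^ k)).subset
  intro m hm
  have := Nat.lt_pow_of_log_lt one_lt_two (show Nat.log 2 (m : ℕ) < k from hm)
  rw [Set.mem_Iic, ← PNat.coe_le_coe, PNat.pow_coe]
  exact this.le

theorem finite_setOf_logLog_lt (k : ℕ) : {m : ℕ+ | logLog m < k}.Finite :=
  (finite_setOf_log_lt (2 ^ k)).subset fun _ hm => Nat.lt_pow_of_log_lt one_lt_two hm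

theorem logLog_two_pow (k : ℕ) : logLog (2 ^ 2 ^ k) = k := by
  simp [logLog, Nat.log_pow]

/-! ### Shift equivalence -/

/-- Two ultrafilters on `ℕ` are shift equivalent if some translates of them coincide. -/
def ShiftEquiv (u v : Ultrafilter ℕ) : Prop :=
  ∃ a b : ℕ, u.map (· + a) = v.map (· + b)

theorem ShiftEquiv.symm {u v : Ultrafilter ℕ} (h : ShiftEquiv u v) : ShiftEquiv v u :=
  let ⟨a, b, h⟩ := h
  ⟨b, a, h.symm⟩

theorem ShiftEquiv.trans {u v w : Ultrafilter ℕ} (h : ShiftEquiv u v) (h' : ShiftEquiv v w) :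
    ShiftEquiv u w := by
  obtain ⟨a, b, h⟩ := h
  obtain ⟨c, d, h'⟩ := h'
  refine ⟨a + c, d + b, ?_⟩
  have e (w : Ultrafilter ℕ) (a b : ℕ) : w.map (· + (a + b)) = (w.map (· + a)).map (· + b) := by
    rw [Ultrafilter.map_map]
    congr 1
    funext x
    simp [add_assoc]
  rw [e, e, h, ← h', ← e, ← e, add_comm]

/-- Pushing forward along a translation is injective, so each pair (a, b) admits at most one v. -/
theorem countable_setOf_shiftEquiv (u : Ultrafilter ℕ) : {v | ShiftEquiv u v}.Countable := by
  have : {v | ShiftEquiv u v} ⊆ ⋃ ab : ℕ × ℕ, {v | u.map (· + ab.1) = v.map (· + ab.2)} := by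
    rintro v ⟨a, b, h⟩
    exact Set.mem_iUnion.2 ⟨(a, b), h⟩
  refine (Set.countable_iUnion fun ab => Set.Subsingleton.countable ?_).mono this
  intro v hv w hw
  have h : v.map (· + ab.2) = w.map (· + ab.2) := hv.symm.trans hw
  have h' : Filter.map (· + ab.2) (v : Filter ℕ) = Filter.map (· + ab.2) (w : Filter ℕ) :=
    congrArg (fun u : Ultrafilter ℕ => (u : Filter ℕ)) h
  exact Ultrafilter.coe_injective (Filter.map_injective (add_left_injective _) h')

/-! ### Nonprincipal ultrafilters and left ideals -/

theorem mem_NStar_iff {p : BetaN} : p ∈ NStar ↔ ∀ s : Set ℕ+, s.Finite → s ∉ p := by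
  constructor
  · intro hp s hs hsp
    obtain ⟨n, -, hn⟩ := Ultrafilter.eq_pure_of_finite_mem hs hsp
    exact hp ⟨n, hn.symm⟩
  · rintro hp ⟨n, rfl⟩
    exact hp {n} (Set.finite_singleton n) (by simp)

theorem compl_mem_of_finite {p : BetaN} (hp : p ∈ NStar) {s : Set ℕ+} (hs : s.Finite) :
    sᶜ ∈ p :=
  Ultrafilter.compl_mem_iff_notMem.2 (mem_NStar_iff.1 hp s hs)

theorem exists_mem_NStar_of_infinite {A : Set ℕ+} (hA : A.Infinite) : ∃ p ∈ NStar, A ∈ p := by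
  have : (Filter.cofinite ⊓ Filter.principal A).NeBot := hA.cofinite_inf_principal_neBot
  let p := Ultrafilter.of (Filter.cofinite ⊓ Filter.principal A)
  have hp : (p : Filter ℕ+) ≤ Filter.cofinite ⊓ Filter.principal A := Ultrafilter.of_le _
  refine ⟨p, mem_NStar_iff.2 fun s hs => ?_, ?_⟩
  · exact Ultrafilter.compl_mem_iff_notMem.1 ((hp.trans inf_le_left) hs.compl_mem_cofinite)
  · exact (hp.trans inf_le_right) (Filter.mem_principal_self A)

theorem mul_mem_NStar (x : BetaN) {p : BetaN} (hp : p ∈ NStar) : x * p ∈ NStar := by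
  rw [mem_NStar_iff]
  intro s hs h
  rw [BetaN.mem_mul_iff] at h
  obtain ⟨n, hn⟩ := x.nonempty_of_mem h
  exact mem_NStar_iff.1 hp _ (hs.preimage (mul_right_injective n).injOn) hn

theorem pure_one_mul (p : BetaN) : (pure 1 : BetaN) * p = p := by
  ext A
  rw [BetaN.mem_mul_iff, Ultrafilter.mem_pure]
  simp

theorem leftDvd_refl (p : BetaN) : LeftDvd p p := ⟨pure 1, (pure_one_mul p).symm⟩

theorem compatL_refl (p : NStar) : CompatL p p := ⟨p, p.2, leftDvd_refl _, leftDvd_refl _⟩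

theorem CompatL.symm {p q : NStar} : CompatL p q → CompatL q p :=
  fun ⟨r, hr, hp, hq⟩ => ⟨r, hr, hq, hp⟩

theorem simL_equivalence : Equivalence SimL where
  refl p := .single (compatL_refl p)
  symm := fun {p q} h => by
    have : Std.Symm CompatL := ⟨fun _ _ => CompatL.symm⟩
    exact (Relation.TransGen.stdSymm (r := CompatL)).symm p q h
  trans := Relation.TransGen.trans

theorem isLeftIdeal_simLClass (p : NStar) :
    IsLeftIdealBetaN ((Subtype.val : NStar → BetaN) '' simLClass p) := by
  refine ⟨⟨p, p, simL_equivalence.refl p, rfl⟩, ?_⟩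
  rintro x _ ⟨q, hq, rfl⟩
  -- The common left divisor of q and x * q is q itself.
  exact ⟨⟨x * q, mul_mem_NStar x q.2⟩, Relation.TransGen.tail hq ⟨q, q.2, leftDvd_refl _, x, rfl⟩,
    rfl⟩

/-! ### The shift invariant -/

theorem shiftEquiv_logLog_mul (x : BetaN) {p : BetaN} (hp : p ∈ NStar) :
    ShiftEquiv ((x * p).map logLog) (p.map logLog) := by
  have key (n : ℕ+) : {m | logLog (n * m) = logLog m} ∈ p ∨
      {m | logLog (n * m) = logLog m + 1} ∈ p := by
    rw [← Ultrafilter.union_mem_iff]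
    filter_upwards [compl_mem_of_finite hp (finite_setOf_log_lt (Nat.log 2 n + 1))] with m hm
    have h₁ := logLog_le_logLog_mul n m
    have h₂ := logLog_mul_le (not_lt.1 hm)
    change logLog (n * m) = logLog m ∨ logLog (n * m) = logLog m + 1
    omega
  have shift (i : ℕ) (h : {n : ℕ+ | {m | logLog (n * m) = logLog m + i} ∈ p} ∈ x) :
      ShiftEquiv ((x * p).map logLog) (p.map logLog) := by
    refine ⟨0, i, (Ultrafilter.coe_le_coe.1 fun A hA => ?_).symm⟩
    obtain ⟨n, hn, hn'⟩ := x.nonempty_of_mem (Filter.inter_mem h ((BetaN.mem_mul_iff _ _ _).1 hA))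
    have hn₁ : {m | logLog (n * m) = logLog m + i} ∈ p := hn
    have hn₂ : {m | logLog (n * m) ∈ A} ∈ p := hn'
    change {m | logLog m + i ∈ A} ∈ p
    filter_upwards [hn₁, hn₂] with m h₁ h₂
    exact (show logLog (n * m) = logLog m + i from h₁) ▸ h₂
  -- The shift may depend on n, but x selects one value for almost all n.
  have : {n : ℕ+ | {m | logLog (n * m) = logLog m} ∈ p} ∪
      {n : ℕ+ | {m | logLog (n * m) = logLog m + 1} ∈ p} ∈ x :=
    Filter.univ_mem' key
  rcases Ultrafilter.union_mem_iff.1 this with h | h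
  · exact shift 0 h
  · exact shift 1 h

theorem SimL.shiftEquiv {p q : NStar} (h : SimL p q) :
    ShiftEquiv (p.1.map logLog) (q.1.map logLog) := by
  have base {p q : NStar} (h : CompatL p q) :
      ShiftEquiv (p.1.map logLog) (q.1.map logLog) := by
    obtain ⟨r, hr, ⟨x, hx⟩, ⟨y, hy⟩⟩ := h
    rw [hx, hy]
    exact (shiftEquiv_logLog_mul x hr).trans (shiftEquiv_logLog_mul y hr).symm
  induction h with
  | single h => exact base h
  | tail _ h ih => exact ih.trans (base h)

/-! ### Nowhere density -/

theorem exists_sparse_seq {A : Set ℕ+} (hA : A.Infinite) :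
    ∃ f : ℕ → ℕ+, (∀ k, f k ∈ A) ∧ ∀ k, logLog (f k) + k < logLog (f (k + 1)) := by
  have (N : ℕ) : ∃ a ∈ A, N < logLog a := by
    obtain ⟨a, ha, h⟩ := hA.exists_notMem_finite (finite_setOf_logLog_lt (N + 1))
    exact ⟨a, ha, not_le.1 fun h' => h (Nat.lt_succ_of_le h')⟩
  choose g hgA hg using this
  let f : ℕ → ℕ+ := fun k => Nat.rec (g 0) (fun k a => g (logLog a + k)) k
  refine ⟨f, fun k => ?_, fun k => hg _⟩
  cases k <;> exact hgA _

theorem add_lt_of_sparse {t : ℕ → ℕ} (ht : ∀ k, t k + k < t (k + 1)) {i j : ℕ} (hij : i < j) :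
    t i + i < t j := by
  have hmono : StrictMono t := strictMono_nat_of_lt_succ fun k => by have := ht k; omega
  exact (ht i).trans_le (hmono.monotone hij)

/-- The images of two nonprincipal ultrafilters which concentrate on the even and on the odd terms
of a sequence with growing gaps are not shift equivalent. -/
theorem not_shiftEquiv_of_sparse {f : ℕ → ℕ+}
    (hf : ∀ k, logLog (f k) + k < logLog (f (k + 1))) {p q : BetaN} (hp : p ∈ NStar)
    (hq : q ∈ NStar) (hfp : Set.range (fun k => f (2 * k)) ∈ p)
    (hfq : Set.range (fun k => f (2 * k + 1)) ∈ q) :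
    ¬ ShiftEquiv (p.map logLog) (q.map logLog) := by
  rintro ⟨a, b, h⟩
  -- Past index a + b the gaps exceed a + b, so the translates by a and b of the even and odd terms
  -- are disjoint.
  have hfin : (f '' Set.Iic (a + b)).Finite := (Set.finite_Iic _).image f
  have hP : {n | ∃ k, a + b < 2 * k ∧ n = logLog (f (2 * k)) + a} ∈
      (p.map logLog).map (· + a) := by
    change {m | ∃ k, a + b < 2 * k ∧ logLog m + a = logLog (f (2 * k)) + a} ∈ p
    filter_upwards [hfp, compl_mem_of_finite hp hfin] with m hm hm'
    obtain ⟨k, rfl⟩ := hm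
    exact ⟨k, not_le.1 fun hk => hm' ⟨2 * k, hk, rfl⟩, rfl⟩
  have hQ : {n | ∃ k, a + b < 2 * k + 1 ∧ n = logLog (f (2 * k + 1)) + b} ∈
      (q.map logLog).map (· + b) := by
    change {m | ∃ k, a + b < 2 * k + 1 ∧ logLog m + b = logLog (f (2 * k + 1)) + b} ∈ q
    filter_upwards [hfq, compl_mem_of_finite hq hfin] with m hm hm'
    obtain ⟨k, rfl⟩ := hm
    exact ⟨k, not_le.1 fun hk => hm' ⟨2 * k + 1, hk, rfl⟩, rfl⟩
  rw [h] at hP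
  obtain ⟨n, ⟨i, hi, hi'⟩, j, hj, hj'⟩ := Ultrafilter.nonempty_of_mem (Filter.inter_mem hP hQ)
  rcases lt_or_gt_of_ne (show 2 * i ≠ 2 * j + 1 by omega) with hlt | hlt
  · have := add_lt_of_sparse (t := fun k => logLog (f k)) hf hlt
    omega
  · have := add_lt_of_sparse (t := fun k => logLog (f k)) hf hlt
    omega

theorem exists_infinite_subset_disjoint_simLClass (p : NStar) {A : Set ℕ+} (hA : A.Infinite) :
    ∃ B ⊆ A, B.Infinite ∧ ∀ q : NStar, B ∈ q.1 → q ∉ simLClass p := by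
  obtain ⟨f, hfA, hf⟩ := exists_sparse_seq hA
  have hinj : f.Injective := by
    have : StrictMono fun k => logLog (f k) :=
      strictMono_nat_of_lt_succ fun k => by have := hf k; omega
    exact this.injective.of_comp (f := logLog)
  by_cases h : ∃ q : NStar, Set.range (fun k => f (2 * k)) ∈ q.1 ∧ q ∈ simLClass p
  · obtain ⟨q, hq, hqp⟩ := h
    refine ⟨Set.range fun k => f (2 * k + 1), ?_, ?_, fun q' hq' hqp' => ?_⟩
    · rintro _ ⟨k, rfl⟩
      exact hfA _
    · exact Set.infinite_range_of_injective fun i j hij => by have := hinj hij; omega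
    · exact not_shiftEquiv_of_sparse hf q.2 q'.2 hq hq'
        ((SimL.shiftEquiv hqp).symm.trans (SimL.shiftEquiv hqp'))
  · push Not at h
    refine ⟨Set.range fun k => f (2 * k), ?_, ?_, h⟩
    · rintro _ ⟨k, rfl⟩
      exact hfA _
    · exact Set.infinite_range_of_injective fun i j hij => by have := hinj hij; omega

theorem isOpen_setOf_mem_NStar (A : Set ℕ+) : IsOpen {q : NStar | A ∈ q.1} :=
  (ultrafilter_isOpen_basic A).preimage continuous_subtype_val

theorem isNowhereDense_simLClass (p : NStar) : IsNowhereDense (simLClass p) := by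
  rw [IsNowhereDense, Set.eq_empty_iff_forall_notMem]
  intro x hx
  obtain ⟨V, hV, hVx⟩ := isOpen_induced_iff.1 (isOpen_interior (s := closure (simLClass p)))
  have hxV : x.1 ∈ V := by
    rw [← hVx] at hx
    exact hx
  obtain ⟨_, ⟨A, rfl⟩, hxA, hAV⟩ :=
    ultrafilterBasis_is_basis.exists_subset_of_mem_open hxV hV
  have hA : A.Infinite := fun hfin => mem_NStar_iff.1 x.2 A hfin hxA
  obtain ⟨B, hBA, hB, hdisj⟩ := exists_infinite_subset_disjoint_simLClass p hA
  obtain ⟨q, hq, hBq⟩ := exists_mem_NStar_of_infinite hB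
  have hqcl : (⟨q, hq⟩ : NStar) ∈ closure (simLClass p) := by
    apply interior_subset
    rw [← hVx]
    exact hAV (Filter.mem_of_superset hBq hBA)
  obtain ⟨q', hq'B, hq'⟩ := mem_closure_iff.1 hqcl _ (isOpen_setOf_mem_NStar B) hBq
  exact hdisj q' hq'B hq'

/-! ### Counting the classes -/

/-- An independent family of subsets of a countable set, indexed by the subsets of `ℕ`. -/
def independentSet (A : Set ℕ) : Set (Finset ℕ × Finset (Finset ℕ)) :=
  {x | ∃ T ∈ x.2, (T : Set ℕ) = A ∩ x.1}

theorem exists_finset_separating {t : Set (Set ℕ)} (ht : t.Finite) :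
    ∃ F : Finset ℕ, ∀ A ∈ t, ∀ B ∈ t, A ∩ F = B ∩ F → A = B := by
  have (A B : Set ℕ) : ∃ n, (n ∈ A ↔ n ∈ B) → A = B := by
    by_contra! h
    exact (h 0).2 (Set.ext fun n => (h n).1)
  choose d hd using this
  refine ⟨((ht.prod ht).image fun x => d x.1 x.2).toFinset, fun A hA B hB h => hd A B ?_⟩
  have hmem : d A B ∈ (((ht.prod ht).image fun x => d x.1 x.2).toFinset : Set ℕ) := by
    rw [Set.Finite.coe_toFinset]
    exact ⟨(A, B), ⟨hA, hB⟩, rfl⟩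
  have := Set.ext_iff.1 h (d A B)
  rwa [Set.mem_inter_iff, Set.mem_inter_iff, and_iff_left hmem, and_iff_left hmem] at this

theorem exists_ultrafilter_independentSet (S : Set (Set ℕ)) :
    ∃ u : Ultrafilter (Finset ℕ × Finset (Finset ℕ)), ∀ A, independentSet A ∈ u ↔ A ∈ S := by
  classical
  let g : Set ℕ → Set (Finset ℕ × Finset (Finset ℕ)) := fun A =>
    if A ∈ S then independentSet A else (independentSet A)ᶜ
  have hg : (⨅ A, Filter.principal (g A)).NeBot := by
    rw [(Filter.hasBasis_iInf_principal_finite g).neBot_iff]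
    intro t ht
    obtain ⟨F, hF⟩ := exists_finset_separating ht
    -- The second component lists the traces on F of the members of t in S; F separates t, so no
    -- other member of t has a listed trace.
    refine ⟨(F, ({A ∈ ht.toFinset | A ∈ S}).image fun A => {n ∈ F | n ∈ A}), ?_⟩
    rw [Set.mem_iInter₂]
    intro A hA
    have hco (B : Set ℕ) : (({n ∈ F | n ∈ B} : Finset ℕ) : Set ℕ) = B ∩ F := by
      ext n
      simp [and_comm]
    by_cases hAS : A ∈ S
    · simp only [g, if_pos hAS]
      exact ⟨_, Finset.mem_image_of_mem _ (by simp [hA, hAS]), hco A⟩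
    · simp only [g, if_neg hAS]
      rintro ⟨T, hT, hTA⟩
      obtain ⟨B, hB, rfl⟩ := Finset.mem_image.1 hT
      rw [Finset.mem_filter, Set.Finite.mem_toFinset] at hB
      rw [hco] at hTA
      exact hAS (hF B hB.1 A hA hTA ▸ hB.2)
  let u := Ultrafilter.of (⨅ A, Filter.principal (g A))
  have hu (A : Set ℕ) : g A ∈ u :=
    (Ultrafilter.of_le _).trans (iInf_le _ A) (Filter.mem_principal_self _)
  refine ⟨u, fun A => ?_⟩
  have h := hu A
  by_cases hA : A ∈ S
  · simpa [g, hA] using h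
  · simpa [g, hA, Ultrafilter.compl_mem_iff_notMem] using h

theorem mk_ultrafilter_nat_ge : 2 ^ 𝔠 ≤ #(Ultrafilter ℕ) := by
  choose u hu using exists_ultrafilter_independentSet
  have hinj : Function.Injective u := fun S T h => by
    ext A
    rw [← hu, ← hu, h]
  obtain ⟨e⟩ : Nonempty (Finset ℕ × Finset (Finset ℕ) ≃ ℕ) := nonempty_equiv_of_countable
  have hinj' : Function.Injective fun S => (u S).map e := fun S T h => by
    have h' : Filter.map e (u S : Filter _) = Filter.map e (u T : Filter _) :=
      congrArg (fun u : Ultrafilter ℕ => (u : Filter ℕ)) h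
    exact hinj (Ultrafilter.coe_injective (Filter.map_injective e.injective h'))
  simpa [mk_set] using mk_le_of_injective hinj'

theorem mk_NStar_le : #NStar ≤ 2 ^ 𝔠 := by
  have hinj : Function.Injective fun p : NStar => {A : Set ℕ+ | A ∈ p.1} := fun p q h => by
    ext A
    exact Set.ext_iff.1 h A
  simpa [mk_set] using mk_le_of_injective hinj

theorem map_two_pow_mem_NStar {v : Ultrafilter ℕ} (hv : v ∉ Set.range (pure : ℕ → Ultrafilter ℕ)) :
    v.map (fun k => (2 : ℕ+) ^ 2 ^ k) ∈ NStar := by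
  rintro ⟨n, hn⟩
  refine hv ⟨logLog n, ?_⟩
  have := congrArg (Ultrafilter.map logLog) hn
  rw [Ultrafilter.map_map, Ultrafilter.map_pure] at this
  rw [this]
  convert Ultrafilter.map_id v
  exact funext logLog_two_pow

theorem mk_range_simLClass_ge : 2 ^ 𝔠 ≤ #(Set.range simLClass) := by
  classical
  let s : ℕ → ℕ+ := fun k => 2 ^ 2 ^ k
  have hs (v : Ultrafilter ℕ) : (v.map s).map logLog = v := by
    rw [Ultrafilter.map_map]
    convert Ultrafilter.map_id v
    exact funext logLog_two_pow
  -- The value `none` absorbs the countably many principal ultrafilters, so every fibre is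
  -- countable.
  let f : Ultrafilter ℕ → Option (Set.range simLClass) := fun v =>
    if hv : v ∈ Set.range (pure : ℕ → Ultrafilter ℕ) then none
    else some ⟨_, ⟨v.map s, map_two_pow_mem_NStar hv⟩, rfl⟩
  have hf (v w : Ultrafilter ℕ) (hv : v ∉ Set.range (pure : ℕ → Ultrafilter ℕ))
      (h : f w = f v) : ShiftEquiv v w := by
    by_cases hw : w ∈ Set.range (pure : ℕ → Ultrafilter ℕ)
    · simp only [f, dif_pos hw, dif_neg hv] at h
      cases h
    · simp only [f, dif_neg hw, dif_neg hv, Option.some.injEq] at h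
      have h := congrArg Subtype.val h
      dsimp only at h
      have h' : SimL ⟨v.map s, map_two_pow_mem_NStar hv⟩ ⟨w.map s, map_two_pow_mem_NStar hw⟩ := by
        change _ ∈ simLClass _
        rw [← h]
        exact simL_equivalence.refl _
      have := h'.shiftEquiv
      rwa [hs, hs] at this
  have hfib (b : Option (Set.range simLClass)) : #(f ⁻¹' {b}) ≤ ℵ₀ := by
    rw [le_aleph0_iff_set_countable]
    by_cases hb : ∃ v, v ∉ Set.range (pure : ℕ → Ultrafilter ℕ) ∧ f v = b
    · obtain ⟨v, hv, rfl⟩ := hb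
      exact (countable_setOf_shiftEquiv v).mono fun w hw => hf v w hv hw
    · push Not at hb
      exact (Set.countable_range pure).mono fun w hw => by_contra fun hw' => hb w hw' hw
  have h := mk_ultrafilter_nat_ge.trans (mk_le_mk_mul_of_mk_preimage_le f hfib)
  rw [mk_option] at h
  have hc : ℵ₀ < 2 ^ 𝔠 := aleph0_lt_continuum.trans (cantor _)
  by_contra! hlt
  exact absurd h (not_le.2 (mul_lt_of_lt hc.le (add_lt_of_lt hc.le hlt (one_lt_aleph0.trans hc)) hc))

theorem mainTheorem9 :
    Equivalence SimL ∧
    #(Set.range simLClass) = 2 ^ 𝔠 ∧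
    ∀ p : NStar, IsNowhereDense (simLClass p) ∧
      IsLeftIdealBetaN ((Subtype.val : NStar → BetaN) '' simLClass p) :=
  ⟨simL_equivalence, (mk_range_le.trans mk_NStar_le).antisymm mk_range_simLClass_ge,
    fun p => ⟨isNowhereDense_simLClass p, isLeftIdeal_simLClass p⟩⟩
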